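/- Let $A\in\mathbb R^{m_1\times n}$ and $B\in\mathbb R^{m_2\times n}$ be such that the stacked matrix $\begin{bmatrix}A\\B\end{bmatrix}$ has full column rank $n$, and let $$U^TAX=\Sigma_A=\operatorname{diag}\{C_A,\mathbf 0_{l_1,q_1},I_{q_2}\},\qquad V^TBX=\Sigma_B=\operatorname{diag}\{S_B,I_{q_1},\mathbf 0_{l_2,q_2}\}$$ be a GSVD of $(A,B)$: $U,V$ are orthogonal, $X\in\mathbb R^{n\times n}$ is nonsingular, $C_A=\operatorname{diag}\{c_1,\dots,c_q\}$ and $S_B=\operatorname{diag}\{s_1,\dots,s_q\}$ with $0<c_i,s_i<1$ and $c_i^2+s_i^2=1$. Denote by $c_1,\dots,c_n$ all the diagonals of $\Sigma_A$ (one for each column; the $q_1$ columns of the zero block give $0$, the $q_2$ columns of the identity block give $1$), and by $x_1,\dots,x_n$ the columns of $X$. Put $H=A^TA+B^TB$, $S=H^{-1}(A^TA-B^TB)$ and $l(z)=2z^2-1$; then $Sx_i=l(c_i)x_i$. Let $0\le c_{\min}\le c_{\max}\le 1$ and let $$P_S=X_{in}X_{in}^TH+\tfrac12X_eX_e^TH,$$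 where $X_{in}$ consists of the columns of $X$ whose eigenvalue of $S$ lies in $(l(c_{\min}),l(c_{\max}))$ and $X_e$ of those whose eigenvalue equals $l(c_{\min})$ or $l(c_{\max})$. Let $h$ be the step function on $[-1,1]$ that is $1$ on $(l(c_{\min}),l(c_{\max}))$, $\frac12$ at $l(c_{\min})$ and $l(c_{\max})$, and $0$ elsewhere. For an integer $d\ge0$ let $$P=\psi_d(S),\qquad \psi_d=\sum_{j=0}^d\rho_{j,d}\,\eta_jT_j,$$ where $T_j$ are the Chebyshev polynomials of the first kind, $\eta_0=\frac1\pi\int_{-1}^1\frac{h(x)}{\sqrt{1-x^2}}\,dx$ and $\eta_j=\frac2\pi\int_{-1}^1\frac{h(x)T_j(x)}{\sqrt{1-x^2}}\,dx$ $(j\ge1)$ are the Chebyshev coefficients of $h$, and $$\rho_{j,d}=\frac{(d+2-j)\sin\frac{\pi}{d+2}\cos\frac{j\pi}{d+2}+\cos\frac{\pi}{d+2}\sin\frac{j\pi}{d+2}}{(d+2)\sin\frac{\pi}{d+2}}$$ are the Jackson damping factors. Let $\alpha=\arccos(l(c_{\min}))$, $\beta=\arccos(l(c_{\max}))$. Let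 $c_{il}$ and $c_{ir}$ be the diagonals of $\Sigma_A$ in $(c_{\min},c_{\max})$ closest to $c_{\min}$ and to $c_{\max}$ respectively, $c_{ol}$ the diagonal smaller than $c_{\min}$ and closest to it, and $c_{or}$ the diagonal larger than $c_{\max}$ and closest to it. Let $$\Delta_{\min}=\min\{|\arccos(l(c_{il}))-\alpha|,\ |\arccos(l(c_{ir}))-\beta|,\ |\arccos(l(c_{ol}))-\alpha|,\ |\arccos(l(c_{or}))-\beta|\},$$ where at least one of $c_{il},c_{ir},c_{ol},c_{or}$ is supposed to exist and the terms of those that do not exist are omitted. If $c_{\min}$ is itself a diagonal of $\Sigma_A$, suppose that $c_{ol}$ and $c_{il}$ exist; if $c_{\max}$ is, suppose that $c_{or}$ and $c_{ir}$ exist. Then, with $\|\cdot\|$ the spectral norm and $\kappa$ the 2-norm condition number of $\begin{bmatrix}A\\B\end{bmatrix}$, $$\|P_S-P\|\le\frac{\pi^6\kappa}{2(d+2)^3\Delta_{\min}^4}.$$ Moreover, with $\gamma_i=\psi_d(l(c_i))$ we have $PX=X\operatorname{diag}(\gamma_1,\dots,\gamma_n)$, that is, $\gamma_1,\dots,\gamma_n$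 are the eigenvalues of $P$ with eigenvectors $x_1,\dots,x_n$, and if $$d>\frac{\sqrt[3]{2}\,\pi^2}{\Delta_{\min}^{4/3}}-2,$$ then $\frac34<\gamma_i\le1$ for every $i$ with $c_i\in(c_{\min},c_{\max})$, $\frac14<\gamma_i<\frac34$ for every $i$ with $c_i\in\{c_{\min},c_{\max}\}$, and $0\le\gamma_i<\frac14$ for every $i$ with $c_i\notin[c_{\min},c_{\max}]$. -/

import Mathlib

open scoped Matrix Matrix.Norms.L2Operator

namespace CJGSVD

noncomputable section

/-! ### The generalized singular value decomposition -/

/-- A GSVD of the pair `(A, B)`: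
`Uᵀ A X = Σ_A = diag{C_A, 0_{l₁,q₁}, I_{q₂}}` and `Vᵀ B X = Σ_B = diag{S_B, I_{q₁}, 0_{l₂,q₂}}`
with `U`, `V` orthogonal, `X` nonsingular, `C_A = diag{c₁,…,c_q}`, `S_B = diag{s₁,…,s_q}`.
The columns of `X` are indexed by the three column blocks, those of `U` and `V` by the
row blocks of `Σ_A` and `Σ_B`. -/
structure GSVD {m₁ m₂ n : ℕ} (A : Matrix (Fin m₁) (Fin n) ℝ) (B : Matrix (Fin m₂) (Fin n) ℝ) where
  (q q₁ q₂ l₁ l₂ : ℕ)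
  U : Matrix (Fin m₁) (Fin q ⊕ Fin l₁ ⊕ Fin q₂) ℝ
  V : Matrix (Fin m₂) (Fin q ⊕ Fin q₁ ⊕ Fin l₂) ℝ
  X : Matrix (Fin n) (Fin q ⊕ Fin q₁ ⊕ Fin q₂) ℝ
  c : Fin q → ℝ
  s : Fin q → ℝ
  U_orth : Uᵀ * U = 1 ∧ U * Uᵀ = 1
  V_orth : Vᵀ * V = 1 ∧ V * Vᵀ = 1
  X_nonsing : ∃ Y : Matrix (Fin q ⊕ Fin q₁ ⊕ Fin q₂) (Fin n) ℝ, X * Y = 1 ∧ Y * X = 1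
  c_mem : ∀ i, 0 < c i ∧ c i < 1
  s_mem : ∀ i, 0 < s i ∧ s i < 1
  sq_add_sq : ∀ i, c i ^ 2 + s i ^ 2 = 1
  decompA : Uᵀ * A * X =
    Matrix.fromBlocks (Matrix.diagonal c) 0 0
      (Matrix.fromBlocks (0 : Matrix (Fin l₁) (Fin q₁) ℝ) 0 0 (1 : Matrix (Fin q₂) (Fin q₂) ℝ))
  decompB : Vᵀ * B * X =
    Matrix.fromBlocks (Matrix.diagonal s) 0 0
      (Matrix.fromBlocks (1 : Matrix (Fin q₁) (Fin q₁) ℝ) 0 0 (0 : Matrix (Fin l₂) (Fin q₂) ℝ))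

/-- Index type of the `n` columns of `X` (equivalently, of the diagonals of `Σ_A`). -/
abbrev GSVD.Col {m₁ m₂ n : ℕ} {A : Matrix (Fin m₁) (Fin n) ℝ} {B : Matrix (Fin m₂) (Fin n) ℝ}
    (g : GSVD A B) : Type := Fin g.q ⊕ Fin g.q₁ ⊕ Fin g.q₂

/-- The diagonals `c₁, …, c_n` of `Σ_A`: the nontrivial `c_i`, then `q₁` zeros, then `q₂` ones. -/
def GSVD.diagA {m₁ m₂ n : ℕ} {A : Matrix (Fin m₁) (Fin n) ℝ} {B : Matrix (Fin m₂) (Fin n) ℝ}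
    (g : GSVD A B) : g.Col → ℝ :=
  Sum.elim g.c (Sum.elim (fun _ => 0) (fun _ => 1))

/-- The diagonals `s₁, …, s_n` of `Σ_B`: the nontrivial `s_i`, then `q₁` ones, then `q₂` zeros. -/
def GSVD.diagB {m₁ m₂ n : ℕ} {A : Matrix (Fin m₁) (Fin n) ℝ} {B : Matrix (Fin m₂) (Fin n) ℝ}
    (g : GSVD A B) : g.Col → ℝ :=
  Sum.elim g.s (Sum.elim (fun _ => 1) (fun _ => 0))

/-- The eigenvalue `c² - s²` of `S` that belongs to a column of `X`. -/
def GSVD.eigS {m₁ m₂ n : ℕ} {A : Matrix (Fin m₁) (Fin n) ℝ} {B : Matrix (Fin m₂) (Fin n) ℝ}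
    (g : GSVD A B) (k : g.Col) : ℝ := g.diagA k ^ 2 - g.diagB k ^ 2

/-- `H = AᵀA + BᵀB`. -/
def matH {m₁ m₂ n : ℕ} (A : Matrix (Fin m₁) (Fin n) ℝ) (B : Matrix (Fin m₂) (Fin n) ℝ) :
    Matrix (Fin n) (Fin n) ℝ := Aᵀ * A + Bᵀ * B

/-- `S = H⁻¹ (AᵀA - BᵀB)`. -/
def matS {m₁ m₂ n : ℕ} (A : Matrix (Fin m₁) (Fin n) ℝ) (B : Matrix (Fin m₂) (Fin n) ℝ) :
    Matrix (Fin n) (Fin n) ℝ := (matH A B)⁻¹ * (Aᵀ * A - Bᵀ * B)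

/-- The map `l(z) = 2 z² - 1` from `[0,1]` onto `[-1,1]`. -/
def lmap (z : ℝ) : ℝ := 2 * z ^ 2 - 1

/-- `X_in`: the columns of `X` whose eigenvalue lies in the open interval
`(l(c_min), l(c_max))`. -/
def GSVD.Xin {m₁ m₂ n : ℕ} {A : Matrix (Fin m₁) (Fin n) ℝ} {B : Matrix (Fin m₂) (Fin n) ℝ}
    (g : GSVD A B) (cmin cmax : ℝ) :
    Matrix (Fin n) {k : g.Col // lmap cmin < g.eigS k ∧ g.eigS k < lmap cmax} ℝ :=
  g.X.submatrix id Subtype.val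

/-- `X_e`: the columns of `X` whose eigenvalue equals `l(c_min)` or `l(c_max)`. -/
def GSVD.Xe {m₁ m₂ n : ℕ} {A : Matrix (Fin m₁) (Fin n) ℝ} {B : Matrix (Fin m₂) (Fin n) ℝ}
    (g : GSVD A B) (cmin cmax : ℝ) :
    Matrix (Fin n) {k : g.Col // g.eigS k = lmap cmin ∨ g.eigS k = lmap cmax} ℝ :=
  g.X.submatrix id Subtype.val

open Classical in
/-- The spectral projector `P_S = X_in X_inᵀ H + ½ X_e X_eᵀ H` of `S` associated with
`c ∈ [c_min, c_max]`. -/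
def GSVD.specProj {m₁ m₂ n : ℕ} {A : Matrix (Fin m₁) (Fin n) ℝ} {B : Matrix (Fin m₂) (Fin n) ℝ}
    (g : GSVD A B) (cmin cmax : ℝ) : Matrix (Fin n) (Fin n) ℝ :=
  g.Xin cmin cmax * (g.Xin cmin cmax)ᵀ * matH A B +
    (1 / 2 : ℝ) • (g.Xe cmin cmax * (g.Xe cmin cmax)ᵀ * matH A B)

/-- The 2-norm condition number `‖M‖ ‖M⁺‖` of a matrix `M` of full column rank, for which the
pseudoinverse is `M⁺ = (MᵀM)⁻¹Mᵀ`; here `‖·‖` is the spectral norm. -/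
def condNumber {ι κ : Type} [Fintype ι] [DecidableEq ι] [Fintype κ] [DecidableEq κ]
    (M : Matrix ι κ ℝ) : ℝ := ‖M‖ * ‖(Mᵀ * M)⁻¹ * Mᵀ‖

/-! ### The Chebyshev–Jackson series of a step function -/

open Classical in
/-- The step function on `[-1,1]`: `1` on `(a,b)`, `1/2` at `a` and `b`, `0` elsewhere. -/
def stepFun (a b x : ℝ) : ℝ :=
  if a < x ∧ x < b then 1 else if x = a ∨ x = b then 1 / 2 else 0

/-- The `j`-th coefficient of the Chebyshev series of `f` on `[-1,1]`, namely
`(1/π) ∫ f(x) (1-x²)^{-1/2} dx` for `j = 0`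
and `(2/π) ∫ f(x) T_j(x) (1-x²)^{-1/2} dx` for `j ≥ 1`. -/
def chebCoeff (f : ℝ → ℝ) (j : ℕ) : ℝ :=
  (if j = 0 then 1 / Real.pi else 2 / Real.pi) *
    ∫ x in (-1 : ℝ)..1, f x * (Polynomial.Chebyshev.T ℝ (j : ℤ)).eval x * (Real.sqrt (1 - x ^ 2))⁻¹

/-- The Jackson damping factor
`ρ_{j,d} = ((d+2-j) sin(π/(d+2)) cos(jπ/(d+2)) + cos(π/(d+2)) sin(jπ/(d+2))) / ((d+2) sin(π/(d+2)))`
(the subtraction is that of the reals). -/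
def jackson (j d : ℕ) : ℝ :=
  (((d : ℝ) + 2 - j) * Real.sin (Real.pi / (d + 2)) * Real.cos (j * Real.pi / (d + 2)) +
      Real.cos (Real.pi / (d + 2)) * Real.sin (j * Real.pi / (d + 2))) /
    (((d : ℝ) + 2) * Real.sin (Real.pi / (d + 2)))

/-- The Chebyshev–Jackson series `ψ_d = ∑_{j=0}^d ρ_{j,d} η_j T_j` of degree `d` of the step
function with jumps at `l(c_min)` and `l(c_max)`, as a polynomial. -/
def psi (cmin cmax : ℝ) (d : ℕ) : Polynomial ℝ :=
  ∑ j ∈ Finset.range (d + 1),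
    (jackson j d * chebCoeff (stepFun (lmap cmin) (lmap cmax)) j) •
      Polynomial.Chebyshev.T ℝ (j : ℤ)

/-- `P = ψ_d(S)`. -/
def approxProj {m₁ m₂ n : ℕ} (A : Matrix (Fin m₁) (Fin n) ℝ) (B : Matrix (Fin m₂) (Fin n) ℝ)
    (cmin cmax : ℝ) (d : ℕ) : Matrix (Fin n) (Fin n) ℝ :=
  Polynomial.aeval (matS A B) (psi cmin cmax d)

/-! ### The gaps -/

/-- The angle `arccos(l(z))`. -/
def angle (z : ℝ) : ℝ := Real.arccos (lmap z)

/-- `z` is an element of `E` that is closest to `a`. -/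
def IsClosest (E : Set ℝ) (a z : ℝ) : Prop := z ∈ E ∧ ∀ w ∈ E, |z - a| ≤ |w - a|

/-- The set of those of the gaps `Δ_il`, `Δ_ir`, `Δ_ol`, `Δ_or` that exist, for the set `D` of
diagonals of `Σ_A`: `c_il` and `c_ir` are the elements of `D` inside `(c_min, c_max)` closest to
`c_min` and to `c_max`, `c_ol` is the element of `D` left of `c_min` closest to it, and `c_or` the
element of `D` right of `c_max` closest to it. -/
def gapSet (D : Set ℝ) (cmin cmax : ℝ) : Set ℝ :=
  {δ | (∃ z, IsClosest (D ∩ Set.Ioo cmin cmax) cmin z ∧ δ = |angle z - angle cmin|) ∨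
       (∃ z, IsClosest (D ∩ Set.Ioo cmin cmax) cmax z ∧ δ = |angle z - angle cmax|) ∨
       (∃ z, IsClosest (D ∩ Set.Iio cmin) cmin z ∧ δ = |angle z - angle cmin|) ∨
       (∃ z, IsClosest (D ∩ Set.Ioi cmax) cmax z ∧ δ = |angle z - angle cmax|)}

end

end CJGSVD

/-!
In the variable `θ`, `x = cos θ`, the Chebyshev–Jackson series of a function `f` is the convolution
of `f ∘ cos` with the Jackson kernel `K`, which has mean `1` and is nonnegative, being a multiple of
the square of the modulus of `∑ k, sin ((k + 1) π / (d + 2)) exp (i k t)` (`jacksonKernel_nonneg`,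
`eval_chebJackson_cos`). In particular the series of a function with values in `[0, 1]` has values
in `[0, 1]`.

The mean of `K(t) (1 - cos t)²` involves only the first two damping factors and can be evaluated
exactly; as `t⁴ ≤ (π⁴ / 4) (1 - cos t)²` on `[0, π]`, this bounds the mean of `K(t) t⁴` by
`π⁶ / (2 (d + 2)³)` (`integral_jacksonKernel_mul_pow_four_le`). If the symmetric means
`(f (cos (θ + t)) + f (cos (θ - t))) / 2` agree with `f (cos θ)` for `t < δ`, the error of the
series at `cos θ` is at most the mean of `K(t) (t / δ)⁴` (`abs_eval_chebJackson_cos_sub_le`).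
For the step function this holds with `δ` the smallest gap at every diagonal of `Σ_A`: away from the
jumps the step function is locally constant, and at a jump its one-sided values `0` and `1` have
mean `1 / 2`, provided that the other jump and the end of `[0, π]` are not closer than `δ`, which
is what the existence of neighbours on both sides ensures (`separated_angle`,
`Separated.mean_stepFun_eq`).

Finally, `X⁻¹ = Xᵀ H` diagonalizes both projectors, so that their difference is `X E X⁻¹` with
`E` the diagonal matrix of these errors, and `‖X‖ ‖X⁻¹‖` is the condition number of the stacked
matrix because `X Xᵀ = H⁻¹` (`GSVD.norm_mul_norm_inv`).
-/

namespace CJGSVD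

section Kernel

/-! ### The Jackson kernel -/

open Finset MeasureTheory

/-- The Jackson kernel `ρ₀ + 2 ∑_{j=1}^d ρ_j cos (j t)`. -/
noncomputable def jacksonKernel (d : ℕ) (t : ℝ) : ℝ :=
  ∑ j ∈ range (d + 1), (if j = 0 then 1 else 2) * jackson j d * Real.cos (j * t)

lemma sin_pi_div_add_two_pos (d : ℕ) : 0 < Real.sin (Real.pi / (d + 2)) := by
  apply Real.sin_pos_of_pos_of_lt_pi
  · positivity
  · exact div_lt_self Real.pi_pos (by linarith [(Nat.cast_nonneg d : (0 : ℝ) ≤ d)])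

lemma four_mul_sin_mul_sum_sin_mul_sin (x y : ℝ) (n : ℕ) :
    4 * Real.sin x * ∑ k ∈ range n, Real.sin ((k + 1) * x) * Real.sin ((k + 1) * x + y) =
      2 * n * Real.sin x * Real.cos y - Real.sin ((2 * n + 1) * x + y) + Real.sin (x + y) := by
  induction n with
  | zero => simp
  | succ n ih =>
    rw [sum_range_succ, mul_add, ih]
    push_cast
    have h1 : Real.sin ((2 * (n + 1) + 1) * x + y)
        = Real.sin (((n + 1) * x + ((n + 1) * x + y)) + x) := by ring_nf
    have h2 : Real.sin ((2 * n + 1) * x + y)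
        = Real.sin (((n + 1) * x + ((n + 1) * x + y)) - x) := by ring_nf
    have h3 : Real.cos y = Real.cos (((n + 1) * x + y) - (n + 1) * x) := by ring_nf
    rw [h1, h2, h3]
    simp only [Real.sin_add _ x, Real.sin_sub _ x, Real.cos_sub, Real.cos_add ((n + 1) * x)]
    ring

/-- The damping factors are the autocorrelations of the sequence `sin (k π / (d + 2))`. -/
lemma sum_sin_mul_sin_eq_jackson {j d : ℕ} (hj : j ≤ d) :
    ∑ k ∈ range (d + 1 - j), Real.sin ((k + 1) * (Real.pi / (d + 2))) *
        Real.sin (((k + j : ℕ) + 1) * (Real.pi / (d + 2))) = (d + 2) / 2 * jackson j d := by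
  have hs := sin_pi_div_add_two_pos d
  have hd : (d : ℝ) + 2 ≠ 0 := by positivity
  have key := four_mul_sin_mul_sum_sin_mul_sin (Real.pi / (d + 2)) (j * (Real.pi / (d + 2)))
    (d + 1 - j)
  rw [Nat.cast_sub (by omega)] at key
  have h1 : (2 * (((d + 1 : ℕ) : ℝ) - j) + 1) * (Real.pi / (d + 2)) + j * (Real.pi / (d + 2))
      = 2 * Real.pi - (Real.pi / (d + 2) + j * (Real.pi / (d + 2))) := by
    push_cast; field_simp; ring
  rw [h1, Real.sin_two_pi_sub, Real.sin_add] at key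
  have h2 : ∀ k : ℕ, (((k + j : ℕ) : ℝ) + 1) * (Real.pi / (d + 2))
      = (k + 1) * (Real.pi / (d + 2)) + j * (Real.pi / (d + 2)) := by
    intro k; push_cast; ring
  simp only [h2]
  unfold jackson
  rw [mul_div_assoc (j : ℝ) Real.pi]
  have h4 : 4 * Real.sin (Real.pi / (d + 2)) ≠ 0 := by positivity
  apply mul_left_cancel₀ h4
  rw [key]
  push_cast
  generalize Real.sin (Real.pi / (d + 2)) = s at *
  field_simp
  ring

lemma sum_sum_range_of_symm (f : ℕ → ℕ → ℝ) (hf : ∀ k l, f k l = f l k) (M : ℕ) :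
    ∑ k ∈ range M, ∑ l ∈ range M, f k l =
      ∑ j ∈ range M, (if j = 0 then 1 else 2) * ∑ k ∈ range (M - j), f k (k + j) := by
  induction M with
  | zero => simp
  | succ M ih =>
    have hL : ∑ k ∈ range (M + 1), ∑ l ∈ range (M + 1), f k l =
        ∑ k ∈ range M, ∑ l ∈ range M, f k l + 2 * ∑ k ∈ range M, f k M + f M M := by
      simp only [sum_range_succ, sum_add_distrib, hf M]
      ring
    have hR : ∑ j ∈ range (M + 1), (if j = 0 then (1 : ℝ) else 2) *
          ∑ k ∈ range (M + 1 - j), f k (k + j) =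
        ∑ j ∈ range (M + 1), (if j = 0 then (1 : ℝ) else 2) * ∑ k ∈ range (M - j), f k (k + j) +
        ∑ j ∈ range (M + 1), (if j = 0 then (1 : ℝ) else 2) * f (M - j) M := by
      rw [← sum_add_distrib]
      refine sum_congr rfl fun j hj => ?_
      have hj' : j ≤ M := by simpa [Nat.lt_succ_iff] using hj
      rw [Nat.succ_sub hj', sum_range_succ, Nat.sub_add_cancel hj']
      ring
    rw [hL, hR, ih, sum_range_succ (fun j => _ * ∑ k ∈ range (M - j), f k (k + j)),
      sum_range_succ' (fun j => _ * f (M - j) M), ← sum_range_reflect (fun k => f k M), mul_sum]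
    have : ∀ j, M - 1 - j = M - (j + 1) := fun j => by omega
    simp [this]
    ring

/-- The kernel is `2 / (d + 2)` times the square of the modulus of
`∑ k, sin ((k + 1) π / (d + 2)) exp (i k t)`. -/
lemma jacksonKernel_nonneg (d : ℕ) (t : ℝ) : 0 ≤ jacksonKernel d t := by
  set a : ℕ → ℝ := fun k => Real.sin ((k + 1) * (Real.pi / (d + 2))) with ha
  have h1 := sum_sum_range_of_symm (fun k l => a k * a l * Real.cos ((l : ℝ) * t - k * t))
    (fun k l => by
      rw [← Real.cos_neg (l * t - k * t), neg_sub, mul_comm (a k)]) (d + 1)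
  have h2 : ∑ k ∈ range (d + 1), ∑ l ∈ range (d + 1),
      a k * a l * Real.cos ((l : ℝ) * t - k * t) =
      (∑ k ∈ range (d + 1), a k * Real.cos (k * t)) ^ 2 +
        (∑ k ∈ range (d + 1), a k * Real.sin (k * t)) ^ 2 := by
    simp only [sq, sum_mul_sum, ← sum_add_distrib]
    refine sum_congr rfl fun k _ => sum_congr rfl fun l _ => ?_
    rw [Real.cos_sub]
    ring
  have h3 : ∑ j ∈ range (d + 1), (if j = 0 then (1 : ℝ) else 2) *
      ∑ k ∈ range (d + 1 - j), a k * a (k + j) * Real.cos (((k + j : ℕ) : ℝ) * t - k * t) =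
      (d + 2) / 2 * jacksonKernel d t := by
    rw [jacksonKernel, mul_sum]
    refine sum_congr rfl fun j hj => ?_
    have hj' : j ≤ d := by simpa [Nat.lt_succ_iff] using hj
    have : ∀ k : ℕ, Real.cos (((k + j : ℕ) : ℝ) * t - k * t) = Real.cos (j * t) := by
      intro k; push_cast; ring_nf
    simp only [this]
    rw [← sum_mul, ha, sum_sin_mul_sin_eq_jackson hj']
    ring
  have h4 : 0 ≤ (d + 2 : ℝ) / 2 * jacksonKernel d t := by
    rw [← h3, ← h1, h2]
    positivity
  exact nonneg_of_mul_nonneg_right h4 (by positivity)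

lemma continuous_jacksonKernel (d : ℕ) : Continuous (jacksonKernel d) := by
  unfold jacksonKernel
  fun_prop

lemma integral_cos_mul_cos (j m : ℕ) :
    ∫ t in (0 : ℝ)..Real.pi, Real.cos (j * t) * Real.cos (m * t) =
      if j = m then (if m = 0 then Real.pi else Real.pi / 2) else 0 := by
  have h := Polynomial.Chebyshev.integral_measureT_eq_integral_cos
    (f := fun x => (Polynomial.Chebyshev.T ℝ (j : ℤ)).eval x *
      (Polynomial.Chebyshev.T ℝ (m : ℤ)).eval x)
  simp only [Polynomial.Chebyshev.T_real_cos, Int.cast_natCast] at h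
  rw [← h]
  split_ifs with h1 h2
  · subst h1; subst h2
    exact_mod_cast Polynomial.Chebyshev.integral_eval_T_real_mul_self_measureT_zero
  · subst h1
    exact Polynomial.Chebyshev.integral_T_real_mul_self_measureT_of_ne_zero h2
  · exact Polynomial.Chebyshev.integral_eval_T_real_mul_eval_T_real_measureT_of_ne h1

lemma jackson_zero (d : ℕ) : jackson 0 d = 1 := by
  have hs := sin_pi_div_add_two_pos d
  have hd : (d : ℝ) + 2 ≠ 0 := by positivity
  simp only [jackson, Nat.cast_zero, zero_mul, zero_div, Real.cos_zero, Real.sin_zero]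
  field_simp
  ring

lemma jackson_one (d : ℕ) : jackson 1 d = Real.cos (Real.pi / (d + 2)) := by
  have hs := sin_pi_div_add_two_pos d
  have hd : (d : ℝ) + 2 ≠ 0 := by positivity
  simp only [jackson, Nat.cast_one, one_mul]
  generalize Real.sin (Real.pi / (d + 2)) = s at *
  field_simp
  ring

lemma jackson_two (d : ℕ) : jackson 2 d = 2 * Real.cos (Real.pi / (d + 2)) ^ 2 - 1 +
    2 * Real.sin (Real.pi / (d + 2)) ^ 2 / (d + 2) := by
  have hs := sin_pi_div_add_two_pos d
  have hd : (d : ℝ) + 2 ≠ 0 := by positivity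
  simp only [jackson, Nat.cast_ofNat, mul_div_assoc (2 : ℝ) Real.pi, Real.cos_two_mul,
    Real.sin_two_mul]
  have h := Real.sin_sq_add_cos_sq (Real.pi / (d + 2))
  generalize Real.sin (Real.pi / (d + 2)) = s at *
  generalize Real.cos (Real.pi / (d + 2)) = c at *
  field_simp
  linear_combination (-2) * h

lemma jackson_add_one (d : ℕ) : jackson (d + 1) d = 0 := by
  have hd : (d : ℝ) + 2 ≠ 0 := by positivity
  have h : ((d + 1 : ℕ) : ℝ) * Real.pi / (d + 2) = Real.pi - Real.pi / (d + 2) := by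
    push_cast; field_simp; ring
  simp only [jackson, h, Real.cos_pi_sub, Real.sin_pi_sub]
  push_cast
  ring

lemma jackson_add_two (d : ℕ) : jackson (d + 2) d = 0 := by
  have hd : (d : ℝ) + 2 ≠ 0 := by positivity
  have h : ((d + 2 : ℕ) : ℝ) * Real.pi / (d + 2) = Real.pi := by
    push_cast; field_simp
  simp only [jackson, h, Real.sin_pi]
  push_cast
  ring

/-- The cosine moments of the kernel. The formula for `jackson` vanishes at `d + 1` and `d + 2`,
so that it also covers two orders beyond the degree of the kernel. -/
lemma integral_jacksonKernel_mul_cos {d m : ℕ} (hm : m ≤ d + 2) :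
    ∫ t in (0 : ℝ)..Real.pi, jacksonKernel d t * Real.cos (m * t) = Real.pi * jackson m d := by
  have h : ∀ t, jacksonKernel d t * Real.cos (m * t) = ∑ j ∈ range (d + 1),
      (if j = 0 then 1 else 2) * jackson j d * (Real.cos (j * t) * Real.cos (m * t)) := by
    intro t
    rw [jacksonKernel, sum_mul]
    exact sum_congr rfl fun j _ => by ring
  simp only [h]
  rw [intervalIntegral.integral_finsetSum
    (fun j _ => (by fun_prop : Continuous _).intervalIntegrable _ _)]
  simp only [intervalIntegral.integral_const_mul, integral_cos_mul_cos, mul_ite, mul_zero]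
  rw [sum_ite_eq']
  rcases le_or_gt m d with hmd | hmd
  · rw [if_pos (by simp; omega)]
    split_ifs <;> ring
  · rw [if_neg (by simp; omega)]
    obtain rfl | rfl : m = d + 1 ∨ m = d + 2 := by omega
    · rw [jackson_add_one, mul_zero]
    · rw [jackson_add_two, mul_zero]

lemma integral_jacksonKernel (d : ℕ) :
    ∫ t in (0 : ℝ)..Real.pi, jacksonKernel d t = Real.pi := by
  have := integral_jacksonKernel_mul_cos (d := d) (m := 0) (by omega)
  simpa [jackson_zero] using this

lemma integral_jacksonKernel_mul_one_sub_cos_sq (d : ℕ) :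
    ∫ t in (0 : ℝ)..Real.pi, jacksonKernel d t * (1 - Real.cos t) ^ 2 =
      Real.pi * ((1 - Real.cos (Real.pi / (d + 2))) ^ 2 +
        Real.sin (Real.pi / (d + 2)) ^ 2 / (d + 2)) := by
  have hK := continuous_jacksonKernel d
  have h : ∀ t, jacksonKernel d t * (1 - Real.cos t) ^ 2 =
      3 / 2 * jacksonKernel d t - 2 * (jacksonKernel d t * Real.cos ((1 : ℕ) * t)) +
        1 / 2 * (jacksonKernel d t * Real.cos ((2 : ℕ) * t)) := by
    intro t
    simp only [Nat.cast_one, one_mul, Nat.cast_ofNat, Real.cos_two_mul]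
    ring
  simp only [h]
  rw [intervalIntegral.integral_add, intervalIntegral.integral_sub,
    intervalIntegral.integral_const_mul, intervalIntegral.integral_const_mul,
    intervalIntegral.integral_const_mul, integral_jacksonKernel,
    integral_jacksonKernel_mul_cos (by omega), integral_jacksonKernel_mul_cos (by omega),
    jackson_one, jackson_two]
  · ring
  all_goals exact (by fun_prop : Continuous _).intervalIntegrable _ _

lemma pow_four_le_one_sub_cos_sq {t : ℝ} (h0 : 0 ≤ t) (h1 : t ≤ Real.pi) :
    t ^ 4 ≤ Real.pi ^ 4 / 4 * (1 - Real.cos t) ^ 2 := by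
  have hpi := Real.pi_pos
  have hs := Real.mul_le_sin (x := t / 2) (by positivity) (by linarith)
  have h2 : t ≤ Real.pi * Real.sin (t / 2) := by
    have : t = Real.pi * (2 / Real.pi * (t / 2)) := by field_simp
    rw [this]
    conv_rhs => rw [← this]
    gcongr
  have h3 : 1 - Real.cos t = 2 * Real.sin (t / 2) ^ 2 := by
    have : Real.cos t = Real.cos (2 * (t / 2)) := by ring_nf
    rw [this, Real.cos_two_mul, Real.cos_sq']
    ring
  rw [h3]
  calc t ^ 4 ≤ (Real.pi * Real.sin (t / 2)) ^ 4 := by gcongr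
    _ = _ := by ring

lemma one_sub_cos_sq_add_sin_sq_div_le (d : ℕ) :
    (1 - Real.cos (Real.pi / (d + 2))) ^ 2 + Real.sin (Real.pi / (d + 2)) ^ 2 / (d + 2) ≤
      2 * Real.pi ^ 2 / (d + 2) ^ 3 := by
  have hpi3 := Real.pi_gt_three
  have hpi4 : Real.pi < 3.15 := Real.pi_lt_d2
  rcases Nat.eq_zero_or_pos d with rfl | hd
  · norm_num
    nlinarith
  · have hN : (3 : ℝ) ≤ d + 2 := by
      have : (1 : ℝ) ≤ d := by exact_mod_cast hd
      linarith
    set N : ℝ := d + 2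
    have hx : 0 < Real.pi / N := by positivity
    have h1 : 1 - Real.cos (Real.pi / N) ≤ (Real.pi / N) ^ 2 / 2 := by
      linarith [Real.one_sub_sq_div_two_le_cos (x := Real.pi / N)]
    have h0 : 0 ≤ 1 - Real.cos (Real.pi / N) := by linarith [Real.cos_le_one (Real.pi / N)]
    have h2 : Real.sin (Real.pi / N) ^ 2 ≤ (Real.pi / N) ^ 2 := Real.sin_sq_le_sq
    calc _ ≤ ((Real.pi / N) ^ 2 / 2) ^ 2 + (Real.pi / N) ^ 2 / N := by gcongr
      _ = Real.pi ^ 2 / N ^ 3 * (Real.pi ^ 2 / (4 * N) + 1) := by field_simp; ring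
      _ ≤ Real.pi ^ 2 / N ^ 3 * 2 := by
        gcongr
        have : Real.pi ^ 2 / (4 * N) ≤ 1 := by
          rw [div_le_one (by positivity)]
          nlinarith
        linarith
      _ = _ := by ring

/-- The fourth moment of the Jackson kernel is of order `(d + 2)⁻³`. -/
lemma integral_jacksonKernel_mul_pow_four_le (d : ℕ) :
    ∫ t in (0 : ℝ)..Real.pi, jacksonKernel d t * t ^ 4 ≤
      Real.pi * (Real.pi ^ 6 / (2 * (d + 2) ^ 3)) := by
  have hK := continuous_jacksonKernel d
  calc ∫ t in (0 : ℝ)..Real.pi, jacksonKernel d t * t ^ 4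
      ≤ ∫ t in (0 : ℝ)..Real.pi,
          Real.pi ^ 4 / 4 * (jacksonKernel d t * (1 - Real.cos t) ^ 2) := by
        apply intervalIntegral.integral_mono_on Real.pi_pos.le
        · exact (by fun_prop : Continuous _).intervalIntegrable _ _
        · exact (by fun_prop : Continuous _).intervalIntegrable _ _
        · intro t ht
          have := mul_le_mul_of_nonneg_left (pow_four_le_one_sub_cos_sq ht.1 ht.2)
            (jacksonKernel_nonneg d t)
          linarith
    _ ≤ Real.pi ^ 4 / 4 * (Real.pi * (2 * Real.pi ^ 2 / (d + 2) ^ 3)) := by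
        rw [intervalIntegral.integral_const_mul, integral_jacksonKernel_mul_one_sub_cos_sq]
        have := Real.pi_pos
        gcongr
        exact one_sub_cos_sq_add_sin_sq_div_le d
    _ = _ := by field_simp; ring

end Kernel

section Series

open Finset MeasureTheory

/-! ### The Chebyshev–Jackson series as a convolution -/

lemma chebCoeff_eq_integral_cos (f : ℝ → ℝ) (j : ℕ) :
    chebCoeff f j = (if j = 0 then 1 else 2) / Real.pi *
      ∫ t in (0 : ℝ)..Real.pi, f (Real.cos t) * Real.cos (j * t) := by
  have h := Polynomial.Chebyshev.integral_measureT_eq_integral_cos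
    (f := fun x => f x * (Polynomial.Chebyshev.T ℝ (j : ℤ)).eval x)
  rw [Polynomial.Chebyshev.integral_measureT] at h
  simp only [Polynomial.Chebyshev.T_real_cos, Int.cast_natCast, Real.sqrt_inv] at h
  rw [chebCoeff, h]
  congr 1
  split_ifs <;> rfl

lemma measurable_stepFun (a b : ℝ) : Measurable (stepFun a b) := by
  unfold stepFun
  refine Measurable.ite measurableSet_Ioo measurable_const (Measurable.ite ?_ measurable_const
    measurable_const)
  exact (measurableSet_singleton a).union (measurableSet_singleton b)

lemma stepFun_nonneg (a b x : ℝ) : 0 ≤ stepFun a b x := by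
  unfold stepFun
  split_ifs <;> norm_num

lemma stepFun_le_one (a b x : ℝ) : stepFun a b x ≤ 1 := by
  unfold stepFun
  split_ifs <;> norm_num

variable {f : ℝ → ℝ}

lemma intervalIntegrable_mul_of_mem_Icc (hf : Measurable f) (h0 : ∀ x, 0 ≤ f x)
    (h1 : ∀ x, f x ≤ 1) {u k : ℝ → ℝ} (hu : Measurable u) (hk : Continuous k) (a b : ℝ) :
    IntervalIntegrable (fun t => f (u t) * k t) volume a b := by
  refine (hk.intervalIntegrable a b).mono_fun
    ((hf.comp hu).mul hk.measurable).aestronglyMeasurable (Filter.Eventually.of_forall fun t => ?_)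
  simp only [norm_mul, Real.norm_eq_abs, abs_of_nonneg (h0 _)]
  exact mul_le_of_le_one_left (abs_nonneg _) (h1 _)

/-- The product formula that turns the terms of a Chebyshev series into convolutions. It is
symmetrized in `t`, which keeps a point of discontinuity on the same footing as the others. -/
lemma integral_add_comp_cos_mul_cos (hf : Measurable f) (h0 : ∀ x, 0 ≤ f x) (h1 : ∀ x, f x ≤ 1)
    (θ : ℝ) (j : ℕ) :
    ∫ t in (0 : ℝ)..Real.pi,
        (f (Real.cos (θ + t)) + f (Real.cos (θ - t))) * Real.cos (j * t) =
      2 * Real.cos (j * θ) * ∫ t in (0 : ℝ)..Real.pi, f (Real.cos t) * Real.cos (j * t) := by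
  have hint : ∀ (u k : ℝ → ℝ), Continuous u → Continuous k → ∀ a b,
      IntervalIntegrable (fun t => f (Real.cos (u t)) * k t) volume a b := fun u k hu hk a b =>
    intervalIntegrable_mul_of_mem_Icc hf h0 h1 (Real.continuous_cos.comp hu).measurable hk a b
  have hfold : ∀ F : ℝ → ℝ, (∀ a b, IntervalIntegrable F volume a b) →
      ∫ t in -Real.pi..Real.pi, F t =
        (∫ t in (0 : ℝ)..Real.pi, F t) + ∫ t in (0 : ℝ)..Real.pi, F (-t) := by
    intro F hF
    rw [intervalIntegral.integral_comp_neg, neg_zero, add_comm,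
      intervalIntegral.integral_add_adjacent_intervals (hF _ _) (hF _ _)]
  have hper : Function.Periodic
      (fun t => f (Real.cos t) * Real.cos (j * (t - θ))) (2 * Real.pi) := by
    intro t
    have : (j : ℝ) * (t + 2 * Real.pi - θ) = j * (t - θ) + j * (2 * Real.pi) := by ring
    simp only [this, Real.cos_add_nat_mul_two_pi, Real.cos_add_two_pi]
  calc _ = ∫ t in -Real.pi..Real.pi, f (Real.cos (θ + t)) * Real.cos (j * t) := by
        rw [hfold _ (hint _ _ (by fun_prop) (by fun_prop)),
          ← intervalIntegral.integral_add (hint _ _ (by fun_prop) (by fun_prop) _ _)]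
        · refine intervalIntegral.integral_congr fun t _ => ?_
          simp only [mul_neg, Real.cos_neg, ← sub_eq_add_neg, add_mul]
        · simp only [← sub_eq_add_neg]
          exact hint _ _ (by fun_prop) (by fun_prop) _ _
    _ = ∫ t in -Real.pi..Real.pi, (fun t => f (Real.cos t) * Real.cos (j * (t - θ))) (θ + t) := by
        simp
    _ = ∫ t in -Real.pi..Real.pi, f (Real.cos t) * Real.cos (j * (t - θ)) := by
        rw [intervalIntegral.integral_comp_add_left
          (fun t => f (Real.cos t) * Real.cos (j * (t - θ)))]
        have h2 := hper.intervalIntegral_add_eq (θ - Real.pi) (-Real.pi)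
        rw [show θ - Real.pi + 2 * Real.pi = θ + Real.pi by ring,
          show -Real.pi + 2 * Real.pi = Real.pi by ring, sub_eq_add_neg] at h2
        exact h2
    _ = ∫ t in (0 : ℝ)..Real.pi,
          2 * Real.cos (j * θ) * (f (Real.cos t) * Real.cos (j * t)) := by
        rw [hfold _ (hint _ _ (by fun_prop) (by fun_prop)),
          ← intervalIntegral.integral_add (hint _ _ (by fun_prop) (by fun_prop) _ _)]
        · refine intervalIntegral.integral_congr fun t _ => ?_
          have e1 : (j : ℝ) * (t - θ) = j * t - j * θ := by ring
          have e2 : (j : ℝ) * (-t - θ) = -(j * t + j * θ) := by ring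
          simp only [e1, e2, Real.cos_neg, Real.cos_add, Real.cos_sub]
          ring
        · simp only [Real.cos_neg]
          exact hint _ _ (by fun_prop) (by fun_prop) _ _
    _ = _ := intervalIntegral.integral_const_mul _ _

/-- The Chebyshev–Jackson series of degree `d` of `f`. -/
noncomputable def chebJackson (f : ℝ → ℝ) (d : ℕ) : Polynomial ℝ :=
  ∑ j ∈ range (d + 1), (jackson j d * chebCoeff f j) • Polynomial.Chebyshev.T ℝ (j : ℤ)

/-- The Chebyshev–Jackson series is the convolution of `f ∘ cos` with the Jackson kernel. -/
lemma eval_chebJackson_cos (hf : Measurable f) (h0 : ∀ x, 0 ≤ f x) (h1 : ∀ x, f x ≤ 1)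
    (d : ℕ) (θ : ℝ) :
    Real.pi * (chebJackson f d).eval (Real.cos θ) = ∫ t in (0 : ℝ)..Real.pi,
      (f (Real.cos (θ + t)) + f (Real.cos (θ - t))) / 2 * jacksonKernel d t := by
  have hint : ∀ j : ℕ, IntervalIntegrable
      (fun t => (f (Real.cos (θ + t)) + f (Real.cos (θ - t))) * Real.cos (j * t))
      volume 0 Real.pi := by
    intro j
    simp only [add_mul]
    exact (intervalIntegrable_mul_of_mem_Icc hf h0 h1 (by fun_prop) (by fun_prop) _ _).add
      (intervalIntegrable_mul_of_mem_Icc hf h0 h1 (by fun_prop) (by fun_prop) _ _)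
  have hsum : ∀ t, (f (Real.cos (θ + t)) + f (Real.cos (θ - t))) / 2 * jacksonKernel d t =
      ∑ j ∈ range (d + 1), (if j = 0 then 1 else 2) * jackson j d / 2 *
        ((f (Real.cos (θ + t)) + f (Real.cos (θ - t))) * Real.cos (j * t)) := by
    intro t
    rw [jacksonKernel, mul_sum]
    exact sum_congr rfl fun j _ => by ring
  simp only [hsum]
  rw [intervalIntegral.integral_finsetSum (fun j _ => (hint j).const_mul _), chebJackson,
    Polynomial.eval_finsetSum, mul_sum]
  refine sum_congr rfl fun j _ => ?_
  rw [intervalIntegral.integral_const_mul, integral_add_comp_cos_mul_cos hf h0 h1,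
    Polynomial.eval_smul, Polynomial.Chebyshev.T_real_cos, chebCoeff_eq_integral_cos]
  have := Real.pi_ne_zero
  simp only [smul_eq_mul, Int.cast_natCast]
  field_simp

lemma eval_chebJackson_cos_mem_Icc (hf : Measurable f) (h0 : ∀ x, 0 ≤ f x) (h1 : ∀ x, f x ≤ 1)
    (d : ℕ) (θ : ℝ) : (chebJackson f d).eval (Real.cos θ) ∈ Set.Icc 0 1 := by
  have hpi := Real.pi_pos
  have h := eval_chebJackson_cos hf h0 h1 d θ
  have hK := continuous_jacksonKernel d
  constructor
  · have : 0 ≤ Real.pi * (chebJackson f d).eval (Real.cos θ) := by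
      rw [h]
      refine intervalIntegral.integral_nonneg hpi.le fun t _ => ?_
      have := h0 (Real.cos (θ + t))
      have := h0 (Real.cos (θ - t))
      have := jacksonKernel_nonneg d t
      positivity
    exact nonneg_of_mul_nonneg_right this hpi
  · have : Real.pi * (chebJackson f d).eval (Real.cos θ) ≤ Real.pi * 1 := by
      rw [h, mul_one]
      conv_rhs => rw [← integral_jacksonKernel d]
      refine intervalIntegral.integral_mono_on hpi.le ?_ (hK.intervalIntegrable _ _) fun t _ => ?_
      · simp only [add_div, add_mul, div_mul_eq_mul_div, mul_div_assoc]
        exact (intervalIntegrable_mul_of_mem_Icc hf h0 h1 (by fun_prop) (by fun_prop) _ _).add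
          (intervalIntegrable_mul_of_mem_Icc hf h0 h1 (by fun_prop) (by fun_prop) _ _)
      · refine mul_le_of_le_one_left (jacksonKernel_nonneg d t) ?_
        linarith [h1 (Real.cos (θ + t)), h1 (Real.cos (θ - t))]
    exact le_of_mul_le_mul_left this hpi

/-- If `f ∘ cos` is in the mean locally constant about `θ`, up to distance `δ`, then the error at
`θ` is controlled by the fourth moment of the kernel: the deviation of the symmetric mean is at
most `1 ≤ (t / δ) ^ 4` beyond `δ`, and vanishes before it. -/
lemma abs_eval_chebJackson_cos_sub_le (hf : Measurable f) (h0 : ∀ x, 0 ≤ f x)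
    (h1 : ∀ x, f x ≤ 1) (d : ℕ) {θ δ : ℝ} (hδ : 0 < δ)
    (hloc : ∀ t, 0 ≤ t → t < δ → t ≤ Real.pi →
      (f (Real.cos (θ + t)) + f (Real.cos (θ - t))) / 2 = f (Real.cos θ)) :
    |f (Real.cos θ) - (chebJackson f d).eval (Real.cos θ)| ≤
      Real.pi ^ 6 / (2 * ((d : ℝ) + 2) ^ 3 * δ ^ 4) := by
  have hpi := Real.pi_pos
  have hK := continuous_jacksonKernel d
  set m : ℝ → ℝ := fun t => (f (Real.cos (θ + t)) + f (Real.cos (θ - t))) / 2 with hm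
  have hmint : IntervalIntegrable (fun t => m t * jacksonKernel d t) volume 0 Real.pi := by
    simp only [hm, add_div, add_mul, div_mul_eq_mul_div, mul_div_assoc]
    exact (intervalIntegrable_mul_of_mem_Icc hf h0 h1 (by fun_prop) (by fun_prop) _ _).add
      (intervalIntegrable_mul_of_mem_Icc hf h0 h1 (by fun_prop) (by fun_prop) _ _)
  have hdiff : Real.pi * (f (Real.cos θ) - (chebJackson f d).eval (Real.cos θ)) =
      ∫ t in (0 : ℝ)..Real.pi, (f (Real.cos θ) * jacksonKernel d t - m t * jacksonKernel d t) := by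
    rw [intervalIntegral.integral_sub ((hK.intervalIntegrable _ _).const_mul _) hmint,
      intervalIntegral.integral_const_mul, integral_jacksonKernel, mul_sub,
      eval_chebJackson_cos hf h0 h1]
    ring
  have hbound : ∀ t ∈ Set.Icc 0 Real.pi, |f (Real.cos θ) - m t| ≤ t ^ 4 / δ ^ 4 := by
    intro t ht
    rcases lt_or_ge t δ with htδ | htδ
    · have : m t = f (Real.cos θ) := hloc t ht.1 htδ ht.2
      rw [this, sub_self, abs_zero]
      have := ht.1
      positivity
    · calc |f (Real.cos θ) - m t| ≤ 1 := by
            simp only [hm]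
            rw [abs_le]
            have a0 := h0 (Real.cos θ)
            have a1 := h1 (Real.cos θ)
            have b0 := h0 (Real.cos (θ + t))
            have b1 := h1 (Real.cos (θ + t))
            have c0 := h0 (Real.cos (θ - t))
            have c1 := h1 (Real.cos (θ - t))
            constructor <;> linarith
        _ ≤ t ^ 4 / δ ^ 4 := by
            rw [one_le_div (by positivity)]
            gcongr
  have key : |Real.pi * (f (Real.cos θ) - (chebJackson f d).eval (Real.cos θ))| ≤
      Real.pi * (Real.pi ^ 6 / (2 * (d + 2) ^ 3)) / δ ^ 4 := by
    rw [hdiff]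
    calc _ ≤ ∫ t in (0 : ℝ)..Real.pi,
            |f (Real.cos θ) * jacksonKernel d t - m t * jacksonKernel d t| :=
          intervalIntegral.abs_integral_le_integral_abs hpi.le
      _ ≤ ∫ t in (0 : ℝ)..Real.pi, jacksonKernel d t * t ^ 4 / δ ^ 4 := by
          apply intervalIntegral.integral_mono_on hpi.le
          · exact (((hK.intervalIntegrable _ _).const_mul _).sub hmint).abs
          · exact (by fun_prop : Continuous _).intervalIntegrable _ _
          · intro t ht
            rw [← sub_mul, abs_mul, abs_of_nonneg (jacksonKernel_nonneg d t), mul_comm,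
              mul_div_assoc]
            exact mul_le_mul_of_nonneg_left (hbound t ht) (jacksonKernel_nonneg d t)
      _ ≤ _ := by
          rw [intervalIntegral.integral_div]
          gcongr
          exact integral_jacksonKernel_mul_pow_four_le d
  rw [abs_mul, abs_of_pos hpi, mul_div_assoc] at key
  refine (le_of_mul_le_mul_left key hpi).trans_eq ?_
  field_simp

end Series

section Step

/-! ### The step function near an angle -/

open Set

section StepFunction

variable {α β φ : ℝ}

lemma stepFun_cos_eq_one (hβ : 0 ≤ β) (hα : α ≤ Real.pi) (h1 : β < φ) (h2 : φ < α) :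
    stepFun (Real.cos α) (Real.cos β) (Real.cos φ) = 1 := by
  rw [stepFun, if_pos]
  exact ⟨Real.cos_lt_cos_of_nonneg_of_le_pi (by linarith) hα h2,
    Real.cos_lt_cos_of_nonneg_of_le_pi hβ (by linarith) h1⟩

lemma stepFun_cos_eq_zero_of_lt (hβα : β ≤ α) (hα : α ≤ Real.pi) (h0 : 0 ≤ φ)
    (h1 : φ < β) : stepFun (Real.cos α) (Real.cos β) (Real.cos φ) = 0 := by
  have h2 := Real.cos_lt_cos_of_nonneg_of_le_pi h0 (hβα.trans hα) h1
  have h3 := Real.cos_lt_cos_of_nonneg_of_le_pi h0 hα (h1.trans_le hβα)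
  rw [stepFun, if_neg (fun h => h2.not_gt h.2), if_neg]
  rintro (h | h)
  · exact h3.ne' h
  · exact h2.ne' h

lemma stepFun_cos_eq_zero_of_gt (hβ : 0 ≤ β) (hβα : β ≤ α) (h0 : φ ≤ Real.pi)
    (h1 : α < φ) : stepFun (Real.cos α) (Real.cos β) (Real.cos φ) = 0 := by
  have h2 := Real.cos_lt_cos_of_nonneg_of_le_pi (hβ.trans hβα) h0 h1
  have h3 := Real.cos_lt_cos_of_nonneg_of_le_pi hβ h0 (hβα.trans_lt h1)
  rw [stepFun, if_neg (fun h => h2.not_gt h.1), if_neg]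
  rintro (h | h)
  · exact h2.ne h
  · exact h3.ne h

lemma stepFun_left (a b : ℝ) : stepFun a b a = 1 / 2 := by simp [stepFun]

lemma stepFun_right (a b : ℝ) : stepFun a b b = 1 / 2 := by simp [stepFun]

/-- The position of an angle `θ` relative to the jumps `β ≤ α` of the step function: either it is
at distance at least `δ` from both, or it is one of them, and then the other one and the nearer
end of `[0, π]` are at distance at least `δ`. -/
def Separated (α β δ θ : ℝ) : Prop :=
  (β + δ ≤ θ ∧ θ + δ ≤ α) ∨ α + δ ≤ θ ∨ θ + δ ≤ β ∨
    (θ = α ∧ β + δ ≤ α ∧ α + δ ≤ Real.pi) ∨ (θ = β ∧ β + δ ≤ α ∧ δ ≤ β)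

/-- At a separated angle the symmetric means of the step function are locally constant. At a jump
this holds because the two one-sided values average to `1 / 2`. -/
lemma Separated.mean_stepFun_eq {δ θ t : ℝ} (hβ : 0 ≤ β) (hβα : β ≤ α) (hα : α ≤ Real.pi)
    (h0 : 0 ≤ θ) (hπ : θ ≤ Real.pi) (h : Separated α β δ θ) (ht : 0 ≤ t) (htδ : t < δ) :
    (stepFun (Real.cos α) (Real.cos β) (Real.cos (θ + t)) +
      stepFun (Real.cos α) (Real.cos β) (Real.cos (θ - t))) / 2 =
      stepFun (Real.cos α) (Real.cos β) (Real.cos θ) := by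
  rcases h with ⟨h1, h2⟩ | h1 | h1 | ⟨rfl, h1, h2⟩ | ⟨rfl, h1, h2⟩
  · rw [stepFun_cos_eq_one hβ hα (by linarith) (by linarith),
      stepFun_cos_eq_one hβ hα (by linarith) (by linarith),
      stepFun_cos_eq_one hβ hα (by linarith) (by linarith)]
    norm_num
  · rw [stepFun_cos_eq_zero_of_gt hβ hβα (by linarith : θ - t ≤ _) (by linarith),
      stepFun_cos_eq_zero_of_gt hβ hβα hπ (by linarith)]
    rcases le_total (θ + t) Real.pi with h3 | h3
    · rw [stepFun_cos_eq_zero_of_gt hβ hβα h3 (by linarith)]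
      norm_num
    · rw [← Real.cos_two_pi_sub (θ + t),
        stepFun_cos_eq_zero_of_gt hβ hβα (by linarith) (by linarith)]
      norm_num
  · rw [stepFun_cos_eq_zero_of_lt hβα hα (by linarith : 0 ≤ θ + t) (by linarith),
      stepFun_cos_eq_zero_of_lt hβα hα h0 (by linarith)]
    rcases le_total t θ with h3 | h3
    · rw [stepFun_cos_eq_zero_of_lt hβα hα (by linarith) (by linarith)]
      norm_num
    · rw [← Real.cos_neg (θ - t), stepFun_cos_eq_zero_of_lt hβα hα (by linarith) (by linarith)]
      norm_num
  · rcases ht.eq_or_lt with rfl | ht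
    · simp
    · rw [stepFun_cos_eq_zero_of_gt hβ hβα (by linarith) (by linarith),
        stepFun_cos_eq_one hβ hα (by linarith) (by linarith), stepFun_left]
      norm_num
  · rcases ht.eq_or_lt with rfl | ht
    · simp
    · rw [stepFun_cos_eq_zero_of_lt hβα hα (by linarith : 0 ≤ θ - t) (by linarith),
        stepFun_cos_eq_one hβ hα (by linarith) (by linarith), stepFun_right]
      norm_num

end StepFunction

/-! ### Gaps -/

lemma lmap_strictMonoOn : StrictMonoOn lmap (Icc 0 1) := by
  intro x hx y _ hxy
  have := hx.1
  unfold lmap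
  gcongr

lemma lmap_mem_Icc {z : ℝ} (hz : z ∈ Icc (0 : ℝ) 1) : lmap z ∈ Icc (-1 : ℝ) 1 := by
  obtain ⟨h0, h1⟩ := hz
  unfold lmap
  constructor <;> nlinarith

lemma cos_angle {z : ℝ} (hz : z ∈ Icc (0 : ℝ) 1) : Real.cos (angle z) = lmap z :=
  Real.cos_arccos (lmap_mem_Icc hz).1 (lmap_mem_Icc hz).2

lemma angle_strictAntiOn : StrictAntiOn angle (Icc 0 1) := fun _ hx _ hy hxy =>
  Real.strictAntiOn_arccos (lmap_mem_Icc hx) (lmap_mem_Icc hy) (lmap_strictMonoOn hx hy hxy)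

/-- On one side of `a`, the angular distance to `a` is smallest at the point closest to `a`. -/
lemma le_abs_angle_sub {E : Set ℝ} {a δ : ℝ} (hfin : E.Finite) (hE : E ⊆ Icc 0 1)
    (ha : a ∈ Icc (0 : ℝ) 1) (hside : E ⊆ Ici a ∨ E ⊆ Iic a)
    (h : ∀ w, IsClosest E a w → δ ≤ |angle w - angle a|) {z : ℝ} (hz : z ∈ E) :
    δ ≤ |angle z - angle a| := by
  obtain ⟨w, hw, hmin⟩ := exists_min_image E (fun w => |w - a|) hfin ⟨z, hz⟩
  refine (h w ⟨hw, hmin⟩).trans ?_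
  have hwz := hmin z hz
  have anti := angle_strictAntiOn.antitoneOn
  rcases hside with hs | hs
  · have hw' : a ≤ w := hs hw
    have hz' : a ≤ z := hs hz
    rw [abs_of_nonneg (sub_nonneg.2 hw'), abs_of_nonneg (sub_nonneg.2 hz')] at hwz
    rw [abs_of_nonpos (sub_nonpos.2 (anti ha (hE hw) hw')),
      abs_of_nonpos (sub_nonpos.2 (anti ha (hE hz) hz'))]
    linarith [anti (hE hw) (hE hz) (by linarith)]
  · have hw' : w ≤ a := hs hw
    have hz' : z ≤ a := hs hz
    rw [abs_of_nonpos (sub_nonpos.2 hw'), abs_of_nonpos (sub_nonpos.2 hz')] at hwz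
    rw [abs_of_nonneg (sub_nonneg.2 (anti (hE hw) ha hw')),
      abs_of_nonneg (sub_nonneg.2 (anti (hE hz) ha hz'))]
    linarith [anti (hE hz) (hE hw) (by linarith)]

section Gap

variable {D : Set ℝ} {cmin cmax δ : ℝ}

lemma gap_pos (hD : D ⊆ Icc 0 1) (hmin : 0 ≤ cmin) (hle : cmin ≤ cmax) (hmax : cmax ≤ 1)
    (hδ : δ ∈ gapSet D cmin cmax) : 0 < δ := by
  have hcmin : cmin ∈ Icc (0 : ℝ) 1 := ⟨hmin, hle.trans hmax⟩
  have hcmax : cmax ∈ Icc (0 : ℝ) 1 := ⟨hmin.trans hle, hmax⟩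
  have key : ∀ z ∈ D, ∀ a ∈ Icc (0 : ℝ) 1, z ≠ a → 0 < |angle z - angle a| :=
    fun z hz a ha hne => abs_pos.2 (sub_ne_zero.2 fun h =>
      hne (angle_strictAntiOn.injOn (hD hz) ha h))
  rcases hδ with ⟨z, ⟨hz, -⟩, rfl⟩ | ⟨z, ⟨hz, -⟩, rfl⟩ | ⟨z, ⟨hz, -⟩, rfl⟩ | ⟨z, ⟨hz, -⟩, rfl⟩
  · exact key z hz.1 _ hcmin hz.2.1.ne'
  · exact key z hz.1 _ hcmax hz.2.2.ne
  · exact key z hz.1 _ hcmin (ne_of_lt hz.2)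
  · exact key z hz.1 _ hcmax (ne_of_gt hz.2)

/-- Every point of `D` is separated, to the extent of the smallest gap, from the jumps. -/
lemma separated_angle (hfin : D.Finite) (hD : D ⊆ Icc 0 1) (hmin : 0 ≤ cmin)
    (hle : cmin ≤ cmax) (hmax : cmax ≤ 1)
    (hendl : cmin ∈ D → (D ∩ Iio cmin).Nonempty ∧ (D ∩ Ioo cmin cmax).Nonempty)
    (hendr : cmax ∈ D → (D ∩ Ioi cmax).Nonempty ∧ (D ∩ Ioo cmin cmax).Nonempty)
    (hδ : δ ∈ lowerBounds (gapSet D cmin cmax)) {z : ℝ} (hz : z ∈ D) :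
    Separated (angle cmin) (angle cmax) δ (angle z) := by
  have hcmin : cmin ∈ Icc (0 : ℝ) 1 := ⟨hmin, hle.trans hmax⟩
  have hcmax : cmax ∈ Icc (0 : ℝ) 1 := ⟨hmin.trans hle, hmax⟩
  have anti := angle_strictAntiOn
  have hsub : ∀ s, D ∩ s ⊆ Icc (0 : ℝ) 1 := fun s => inter_subset_left.trans hD
  have hil : ∀ w ∈ D ∩ Ioo cmin cmax, angle w + δ ≤ angle cmin := by
    intro w hw
    have := le_abs_angle_sub (hfin.inter_of_left _) (hsub _) hcmin (Or.inl fun x hx => hx.2.1.le)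
      (fun x hx => hδ (Or.inl ⟨x, hx, rfl⟩)) hw
    rw [abs_of_neg (sub_neg.2 (anti hcmin (hD hw.1) hw.2.1))] at this
    linarith
  have hir : ∀ w ∈ D ∩ Ioo cmin cmax, angle cmax + δ ≤ angle w := by
    intro w hw
    have := le_abs_angle_sub (hfin.inter_of_left _) (hsub _) hcmax (Or.inr fun x hx => hx.2.2.le)
      (fun x hx => hδ (Or.inr (Or.inl ⟨x, hx, rfl⟩))) hw
    rw [abs_of_pos (sub_pos.2 (anti (hD hw.1) hcmax hw.2.2))] at this
    linarith
  have hol : ∀ w ∈ D ∩ Iio cmin, angle cmin + δ ≤ angle w := by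
    intro w hw
    have := le_abs_angle_sub (hfin.inter_of_left _) (hsub _) hcmin
      (Or.inr (inter_subset_right.trans Iio_subset_Iic_self))
      (fun x hx => hδ (Or.inr (Or.inr (Or.inl ⟨x, hx, rfl⟩)))) hw
    rw [abs_of_pos (sub_pos.2 (anti (hD hw.1) hcmin hw.2))] at this
    linarith
  have hor : ∀ w ∈ D ∩ Ioi cmax, angle w + δ ≤ angle cmax := by
    intro w hw
    have := le_abs_angle_sub (hfin.inter_of_left _) (hsub _) hcmax
      (Or.inl (inter_subset_right.trans Ioi_subset_Ici_self))
      (fun x hx => hδ (Or.inr (Or.inr (Or.inr ⟨x, hx, rfl⟩)))) hw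
    rw [abs_of_neg (sub_neg.2 (anti hcmax (hD hw.1) hw.2))] at this
    linarith
  rcases lt_trichotomy z cmin with h | rfl | h
  · exact Or.inr (Or.inl (hol z ⟨hz, h⟩))
  · obtain ⟨⟨u, hu⟩, ⟨w, hw⟩⟩ := hendl hz
    have h1 := hol u hu
    have h2 := hir w hw
    have h3 := anti hcmin (hD hw.1) hw.2.1
    have h4 : angle u ≤ Real.pi := Real.arccos_le_pi _
    exact Or.inr (Or.inr (Or.inr (Or.inl ⟨rfl, by linarith, by linarith⟩)))
  · rcases lt_trichotomy z cmax with h' | rfl | h'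
    · exact Or.inl ⟨hir z ⟨hz, h, h'⟩, hil z ⟨hz, h, h'⟩⟩
    · obtain ⟨⟨u, hu⟩, ⟨w, hw⟩⟩ := hendr hz
      have h1 := hor u hu
      have h2 := hir w hw
      have h3 := anti hcmin (hD hw.1) hw.2.1
      have h4 : 0 ≤ angle u := Real.arccos_nonneg _
      exact Or.inr (Or.inr (Or.inr (Or.inr ⟨rfl, by linarith, by linarith⟩)))
    · exact Or.inr (Or.inr (Or.inl (hor z ⟨hz, h'⟩)))

lemma psi_eq_chebJackson (cmin cmax : ℝ) (d : ℕ) :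
    psi cmin cmax d = chebJackson (stepFun (lmap cmin) (lmap cmax)) d := rfl

lemma eval_psi_mem_Icc (d : ℕ) {z : ℝ} (hz : z ∈ Icc (0 : ℝ) 1) :
    (psi cmin cmax d).eval (lmap z) ∈ Icc 0 1 := by
  rw [psi_eq_chebJackson, ← cos_angle hz]
  exact eval_chebJackson_cos_mem_Icc (measurable_stepFun _ _) (stepFun_nonneg _ _)
    (stepFun_le_one _ _) d _

lemma abs_stepFun_sub_eval_psi_le (hfin : D.Finite) (hD : D ⊆ Icc 0 1) (hmin : 0 ≤ cmin)
    (hle : cmin ≤ cmax) (hmax : cmax ≤ 1)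
    (hendl : cmin ∈ D → (D ∩ Iio cmin).Nonempty ∧ (D ∩ Ioo cmin cmax).Nonempty)
    (hendr : cmax ∈ D → (D ∩ Ioi cmax).Nonempty ∧ (D ∩ Ioo cmin cmax).Nonempty)
    (hδ : IsLeast (gapSet D cmin cmax) δ) (d : ℕ) {z : ℝ} (hz : z ∈ D) :
    |stepFun (lmap cmin) (lmap cmax) (lmap z) - (psi cmin cmax d).eval (lmap z)| ≤
      Real.pi ^ 6 / (2 * ((d : ℝ) + 2) ^ 3 * δ ^ 4) := by
  have hcmin : cmin ∈ Icc (0 : ℝ) 1 := ⟨hmin, hle.trans hmax⟩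
  have hcmax : cmax ∈ Icc (0 : ℝ) 1 := ⟨hmin.trans hle, hmax⟩
  rw [psi_eq_chebJackson, ← cos_angle (hD hz)]
  refine abs_eval_chebJackson_cos_sub_le (measurable_stepFun _ _) (stepFun_nonneg _ _)
    (stepFun_le_one _ _) d (gap_pos hD hmin hle hmax hδ.1) fun t ht htδ _ => ?_
  rw [← cos_angle hcmin, ← cos_angle hcmax]
  exact (separated_angle hfin hD hmin hle hmax hendl hendr hδ.2 hz).mean_stepFun_eq
    (Real.arccos_nonneg _) (angle_strictAntiOn.antitoneOn hcmin hcmax hle)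
    (Real.arccos_le_pi _) (Real.arccos_nonneg _) (Real.arccos_le_pi _) ht htδ

end Gap

lemma pi_pow_six_div_lt_quarter {d : ℕ} {δ : ℝ} (hδ : 0 < δ)
    (hd : (d : ℝ) > (2 : ℝ) ^ (1 / 3 : ℝ) * Real.pi ^ 2 / δ ^ (4 / 3 : ℝ) - 2) :
    Real.pi ^ 6 / (2 * ((d : ℝ) + 2) ^ 3 * δ ^ 4) < 1 / 4 := by
  have hpi := Real.pi_pos
  have h1 : (2 : ℝ) ^ (1 / 3 : ℝ) * Real.pi ^ 2 / δ ^ (4 / 3 : ℝ) < d + 2 := by linarith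
  have h2 : ((2 : ℝ) ^ (1 / 3 : ℝ) * Real.pi ^ 2 / δ ^ (4 / 3 : ℝ)) ^ 3 < ((d : ℝ) + 2) ^ 3 := by
    gcongr
  have h3 : ((2 : ℝ) ^ (1 / 3 : ℝ)) ^ 3 = 2 := by
    rw [← Real.rpow_natCast, ← Real.rpow_mul (by norm_num)]
    norm_num
  have h4 : (δ ^ (4 / 3 : ℝ)) ^ 3 = δ ^ 4 := by
    rw [← Real.rpow_natCast, ← Real.rpow_mul hδ.le]
    norm_num
  rw [div_pow, mul_pow, h3, h4, div_lt_iff₀ (by positivity)] at h2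
  rw [div_lt_iff₀ (by positivity)]
  linarith

end Step

section MatrixAlgebra

/-! ### Matrices -/

open Matrix

lemma norm_eq_of_mul_transpose_eq {ι κ μ : Type*} [Fintype ι] [DecidableEq ι] [Fintype κ]
    [DecidableEq κ] [Fintype μ] [DecidableEq μ] {P : Matrix ι κ ℝ} {Q : Matrix ι μ ℝ}
    (h : P * Pᵀ = Q * Qᵀ) : ‖P‖ = ‖Q‖ := by
  have h1 : ‖P‖ * ‖P‖ = ‖Q‖ * ‖Q‖ := by
    rw [← l2_opNorm_conjTranspose P, ← l2_opNorm_conjTranspose Q]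
    have e1 := l2_opNorm_conjTranspose_mul_self Pᴴ
    have e2 := l2_opNorm_conjTranspose_mul_self Qᴴ
    rw [conjTranspose_conjTranspose, conjTranspose_eq_transpose_of_trivial] at e1 e2
    rw [conjTranspose_eq_transpose_of_trivial, conjTranspose_eq_transpose_of_trivial,
      ← e1, ← e2, h]
  exact (mul_self_inj (norm_nonneg _) (norm_nonneg _)).1 h1

lemma submatrix_mul_transpose_submatrix {ι κ : Type*} [Fintype κ] [DecidableEq κ]
    (X : Matrix ι κ ℝ) (p : κ → Prop) [DecidablePred p] [Fintype {k // p k}] :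
    X.submatrix id (Subtype.val : {k // p k} → κ) *
        (X.submatrix id (Subtype.val : {k // p k} → κ))ᵀ =
      X * diagonal (fun k => if p k then (1 : ℝ) else 0) * Xᵀ := by
  ext i j
  rw [mul_apply, mul_apply]
  simp only [submatrix_apply, transpose_apply, id, mul_diagonal, mul_ite, mul_one, mul_zero,
    ite_mul, zero_mul]
  rw [← Finset.sum_filter, ← Finset.sum_subtype (Finset.univ.filter p) (by simp) (fun k => X i k * X j k)]

namespace GSVD

variable {m₁ m₂ n : ℕ} {A : Matrix (Fin m₁) (Fin n) ℝ} {B : Matrix (Fin m₂) (Fin n) ℝ}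
  (g : GSVD A B)

lemma diagA_mem_Icc (k : g.Col) : g.diagA k ∈ Set.Icc (0 : ℝ) 1 := by
  rcases k with i | i | i
  · exact ⟨(g.c_mem i).1.le, (g.c_mem i).2.le⟩
  · simp [diagA]
  · simp [diagA]

lemma diagA_sq_add_diagB_sq (k : g.Col) : g.diagA k ^ 2 + g.diagB k ^ 2 = 1 := by
  rcases k with i | i | i
  · exact g.sq_add_sq i
  · simp [diagA, diagB]
  · simp [diagA, diagB]

lemma eigS_eq_lmap (k : g.Col) : g.eigS k = lmap (g.diagA k) := by
  have := g.diagA_sq_add_diagB_sq k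
  unfold eigS lmap
  linarith

lemma gramA : g.Xᵀ * (Aᵀ * A) * g.X = diagonal (fun k => g.diagA k ^ 2) := by
  have h : g.Xᵀ * (Aᵀ * A) * g.X = (g.Uᵀ * A * g.X)ᵀ * (g.Uᵀ * A * g.X) := by
    simp only [transpose_mul, transpose_transpose]
    calc _ = g.Xᵀ * (Aᵀ * (g.U * g.Uᵀ) * A) * g.X := by rw [g.U_orth.2, Matrix.mul_one]
      _ = _ := by simp only [Matrix.mul_assoc]
  rw [h, g.decompA]
  simp only [fromBlocks_transpose, fromBlocks_multiply, diagonal_transpose, diagonal_mul_diagonal,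
    transpose_zero, transpose_one, Matrix.mul_zero, Matrix.zero_mul, add_zero, zero_add,
    Matrix.mul_one]
  ext i j
  rcases i with i | i | i <;> rcases j with j | j | j <;>
    simp [diagA, diagonal_apply, Matrix.one_apply, sq]

lemma gramB : g.Xᵀ * (Bᵀ * B) * g.X = diagonal (fun k => g.diagB k ^ 2) := by
  have h : g.Xᵀ * (Bᵀ * B) * g.X = (g.Vᵀ * B * g.X)ᵀ * (g.Vᵀ * B * g.X) := by
    simp only [transpose_mul, transpose_transpose]
    calc _ = g.Xᵀ * (Bᵀ * (g.V * g.Vᵀ) * B) * g.X := by rw [g.V_orth.2, Matrix.mul_one]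
      _ = _ := by simp only [Matrix.mul_assoc]
  rw [h, g.decompB]
  simp only [fromBlocks_transpose, fromBlocks_multiply, diagonal_transpose, diagonal_mul_diagonal,
    transpose_zero, transpose_one, Matrix.mul_zero, Matrix.zero_mul, add_zero, zero_add,
    Matrix.mul_one]
  ext i j
  rcases i with i | i | i <;> rcases j with j | j | j <;>
    simp [diagB, diagonal_apply, Matrix.one_apply, sq]

/-- The inverse of `X` is `Xᵀ H`. -/
lemma transpose_mul_matH_mul : g.Xᵀ * matH A B * g.X = 1 := by
  rw [matH, Matrix.mul_add, Matrix.add_mul, gramA, gramB, diagonal_add]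
  simp only [diagA_sq_add_diagB_sq, diagonal_one]

lemma mul_transpose_mul_matH : g.X * (g.Xᵀ * matH A B) = 1 := by
  obtain ⟨Y, hXY, -⟩ := g.X_nonsing
  have : g.Xᵀ * matH A B = Y := by
    rw [← Matrix.mul_one (g.Xᵀ * matH A B), ← hXY, ← Matrix.mul_assoc, transpose_mul_matH_mul,
      Matrix.one_mul]
  rw [this, hXY]

lemma matH_inv : (matH A B)⁻¹ = g.X * g.Xᵀ :=
  inv_eq_left_inv (by rw [Matrix.mul_assoc, mul_transpose_mul_matH])

lemma matS_mul : matS A B * g.X = g.X * diagonal (fun k => lmap (g.diagA k)) := by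
  have h : matS A B * g.X = g.X * (g.Xᵀ * (Aᵀ * A) * g.X - g.Xᵀ * (Bᵀ * B) * g.X) := by
    rw [matS, g.matH_inv, ← Matrix.sub_mul, ← Matrix.mul_sub]
    simp only [Matrix.mul_assoc]
  rw [h, gramA, gramB, diagonal_sub]
  simp only [← eigS_eq_lmap, eigS]

lemma aeval_matS_mul (p : Polynomial ℝ) : Polynomial.aeval (matS A B) p * g.X =
    g.X * diagonal (fun k => p.eval (lmap (g.diagA k))) := by
  induction p using Polynomial.induction_on' with
  | add p q hp hq =>
    simp only [map_add, Matrix.add_mul, hp, hq, ← Matrix.mul_add, diagonal_add,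
      Polynomial.eval_add]
  | monomial k a =>
    have hpow : matS A B ^ k * g.X = g.X * diagonal (fun i => lmap (g.diagA i) ^ k) := by
      induction k with
      | zero => simp
      | succ k ih =>
        rw [pow_succ, Matrix.mul_assoc, matS_mul, ← Matrix.mul_assoc, ih, Matrix.mul_assoc,
          diagonal_mul_diagonal]
        simp only [pow_succ]
    rw [Polynomial.aeval_monomial, Algebra.algebraMap_eq_smul_one, smul_mul_assoc, one_mul,
      Matrix.smul_mul, hpow, ← Matrix.mul_smul, ← diagonal_smul]
    congr 2
    ext i
    simp [Polynomial.eval_monomial]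

lemma aeval_matS_eq (p : Polynomial ℝ) : Polynomial.aeval (matS A B) p =
    g.X * diagonal (fun k => p.eval (lmap (g.diagA k))) * (g.Xᵀ * matH A B) := by
  rw [← aeval_matS_mul, Matrix.mul_assoc, mul_transpose_mul_matH, Matrix.mul_one]

lemma specProj_eq (cmin cmax : ℝ) : g.specProj cmin cmax =
    g.X * diagonal (fun k => stepFun (lmap cmin) (lmap cmax) (lmap (g.diagA k))) *
      (g.Xᵀ * matH A B) := by
  classical
  unfold specProj Xin Xe
  rw [submatrix_mul_transpose_submatrix, submatrix_mul_transpose_submatrix, ← Matrix.smul_mul,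
    ← Matrix.smul_mul, ← Matrix.mul_smul, ← diagonal_smul, ← Matrix.add_mul, ← Matrix.add_mul,
    ← Matrix.mul_add, diagonal_add, Matrix.mul_assoc _ g.Xᵀ]
  congr 3
  ext k
  simp only [eigS_eq_lmap, stepFun, Pi.smul_apply, smul_eq_mul, mul_ite, mul_one, mul_zero]
  by_cases h : lmap cmin < lmap (g.diagA k) ∧ lmap (g.diagA k) < lmap cmax
  · rw [if_pos h, if_pos h, if_neg (by rintro (h' | h') <;> linarith), add_zero]
  · rw [if_neg h, if_neg h, zero_add]

lemma transpose_fromRows_mul_fromRows (A : Matrix (Fin m₁) (Fin n) ℝ)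
    (B : Matrix (Fin m₂) (Fin n) ℝ) : (fromRows A B)ᵀ * fromRows A B = matH A B := by
  rw [transpose_fromRows, fromCols_mul_fromRows, matH]

lemma transpose_matH (A : Matrix (Fin m₁) (Fin n) ℝ)
    (B : Matrix (Fin m₂) (Fin n) ℝ) : (matH A B)ᵀ = matH A B := by
  simp [matH]

/-- The condition number of `X` is that of the stacked matrix `M`: one has `X Xᵀ = M⁺ (M⁺)ᵀ` and
`(X⁻¹)ᵀ X⁻¹ = Mᵀ M`. -/
lemma norm_mul_norm_inv :
    ‖g.X‖ * ‖g.Xᵀ * matH A B‖ = condNumber (fromRows A B) := by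
  have hM := transpose_fromRows_mul_fromRows A B
  have h1 : ‖g.X‖ = ‖(matH A B)⁻¹ * (fromRows A B)ᵀ‖ := by
    apply norm_eq_of_mul_transpose_eq
    rw [g.matH_inv]
    simp only [transpose_mul, transpose_transpose]
    calc _ = g.X * (g.Xᵀ * matH A B * g.X) * g.Xᵀ := by
          rw [transpose_mul_matH_mul, Matrix.mul_one]
      _ = _ := by rw [← hM]; simp only [Matrix.mul_assoc]
  have h2 : ‖g.Xᵀ * matH A B‖ = ‖fromRows A B‖ := by
    rw [← l2_opNorm_conjTranspose, ← l2_opNorm_conjTranspose (fromRows A B),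
      conjTranspose_eq_transpose_of_trivial, conjTranspose_eq_transpose_of_trivial]
    apply norm_eq_of_mul_transpose_eq
    rw [transpose_transpose, transpose_transpose, hM, transpose_mul, transpose_matH,
      transpose_transpose, Matrix.mul_assoc, mul_transpose_mul_matH, Matrix.mul_one]
  rw [condNumber, hM, h1, h2, mul_comm]

end GSVD

end MatrixAlgebra

end CJGSVD

theorem theorem3p1 {m₁ m₂ n : ℕ}
    (A : Matrix (Fin m₁) (Fin n) ℝ) (B : Matrix (Fin m₂) (Fin n) ℝ)
    (hreg : (Matrix.fromRows A B).rank = n)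
    (g : CJGSVD.GSVD A B)
    (cmin cmax : ℝ) (hmin : 0 ≤ cmin) (hle : cmin ≤ cmax) (hmax : cmax ≤ 1)
    (hendl : cmin ∈ Set.range g.diagA →
      (Set.range g.diagA ∩ Set.Iio cmin).Nonempty ∧
        (Set.range g.diagA ∩ Set.Ioo cmin cmax).Nonempty)
    (hendr : cmax ∈ Set.range g.diagA →
      (Set.range g.diagA ∩ Set.Ioi cmax).Nonempty ∧
        (Set.range g.diagA ∩ Set.Ioo cmin cmax).Nonempty)
    (Δmin : ℝ) (hΔ : IsLeast (CJGSVD.gapSet (Set.range g.diagA) cmin cmax) Δmin)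
    (d : ℕ) :
    ‖g.specProj cmin cmax - CJGSVD.approxProj A B cmin cmax d‖ ≤
        Real.pi ^ 6 * CJGSVD.condNumber (Matrix.fromRows A B) /
          (2 * ((d : ℝ) + 2) ^ 3 * Δmin ^ 4) ∧
      CJGSVD.approxProj A B cmin cmax d * g.X =
        g.X * Matrix.diagonal
          (fun k => (CJGSVD.psi cmin cmax d).eval (CJGSVD.lmap (g.diagA k))) ∧
      ((d : ℝ) > (2 : ℝ) ^ (1 / 3 : ℝ) * Real.pi ^ 2 / Δmin ^ (4 / 3 : ℝ) - 2 →
        ∀ k : g.Col,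
          (g.diagA k ∈ Set.Ioo cmin cmax →
            3 / 4 < (CJGSVD.psi cmin cmax d).eval (CJGSVD.lmap (g.diagA k)) ∧
              (CJGSVD.psi cmin cmax d).eval (CJGSVD.lmap (g.diagA k)) ≤ 1) ∧
          (g.diagA k = cmin ∨ g.diagA k = cmax →
            1 / 4 < (CJGSVD.psi cmin cmax d).eval (CJGSVD.lmap (g.diagA k)) ∧
              (CJGSVD.psi cmin cmax d).eval (CJGSVD.lmap (g.diagA k)) < 3 / 4) ∧
          (g.diagA k ∉ Set.Icc cmin cmax →
            0 ≤ (CJGSVD.psi cmin cmax d).eval (CJGSVD.lmap (g.diagA k)) ∧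
              (CJGSVD.psi cmin cmax d).eval (CJGSVD.lmap (g.diagA k)) < 1 / 4)) := by
  have hfin : (Set.range g.diagA).Finite := Set.finite_range _
  have hD : Set.range g.diagA ⊆ Set.Icc 0 1 := by
    rintro _ ⟨k, rfl⟩
    exact g.diagA_mem_Icc k
  have hΔpos := CJGSVD.gap_pos hD hmin hle hmax hΔ.1
  have herr := fun k => CJGSVD.abs_stepFun_sub_eval_psi_le hfin hD hmin hle hmax hendl hendr hΔ d
    (Set.mem_range_self k)
  refine ⟨?_, g.aeval_matS_mul _, fun hd k => ?_⟩
  · rw [g.specProj_eq, CJGSVD.approxProj, g.aeval_matS_eq, ← Matrix.sub_mul, ← Matrix.mul_sub,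
      Matrix.diagonal_sub, ← g.norm_mul_norm_inv]
    refine (Matrix.l2_opNorm_mul _ _).trans ?_
    refine (mul_le_mul_of_nonneg_right (Matrix.l2_opNorm_mul _ _) (norm_nonneg _)).trans ?_
    rw [Matrix.l2_opNorm_diagonal, mul_right_comm, mul_comm, mul_div_right_comm]
    refine mul_le_mul_of_nonneg_right ?_ (by positivity)
    rw [pi_norm_le_iff_of_nonneg (by positivity)]
    exact herr
  · have hcmin : cmin ∈ Set.Icc (0 : ℝ) 1 := ⟨hmin, hle.trans hmax⟩
    have hcmax : cmax ∈ Set.Icc (0 : ℝ) 1 := ⟨hmin.trans hle, hmax⟩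
    have hk := g.diagA_mem_Icc k
    have mono := CJGSVD.lmap_strictMonoOn
    have hmem := CJGSVD.eval_psi_mem_Icc (cmin := cmin) (cmax := cmax) d hk
    have hlt := abs_lt.1 ((herr k).trans_lt (CJGSVD.pi_pow_six_div_lt_quarter hΔpos hd))
    refine ⟨fun h => ⟨?_, hmem.2⟩, fun h => ?_, fun h => ⟨hmem.1, ?_⟩⟩
    · rw [CJGSVD.stepFun, if_pos ⟨mono hcmin hk h.1, mono hk hcmax h.2⟩] at hlt
      linarith [hlt.2]
    · have hhalf : CJGSVD.stepFun (CJGSVD.lmap cmin) (CJGSVD.lmap cmax)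
          (CJGSVD.lmap (g.diagA k)) = 1 / 2 := by
        rcases h with h | h
        · rw [h, CJGSVD.stepFun_left]
        · rw [h, CJGSVD.stepFun_right]
      rw [hhalf] at hlt
      constructor <;> linarith [hlt.1, hlt.2]
    · have hzero : CJGSVD.stepFun (CJGSVD.lmap cmin) (CJGSVD.lmap cmax)
          (CJGSVD.lmap (g.diagA k)) = 0 := by
        have h1 := mono.lt_iff_lt hcmin hk
        have h2 := mono.lt_iff_lt hk hcmax
        have h3 := mono.injOn.eq_iff hk hcmin
        have h4 := mono.injOn.eq_iff hk hcmax
        rw [Set.mem_Icc, not_and_or, not_le, not_le] at h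
        simp only [CJGSVD.stepFun, h1, h2, h3, h4]
        rw [if_neg, if_neg]
        · rintro (h' | h') <;> rcases h with h | h <;> linarith
        · rintro ⟨h', h''⟩
          rcases h with h | h <;> linarith
      rw [hzero] at hlt
      linarith [hlt.1]
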